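/- Let $r \ge 3$ be an integer. For an abelian group $G$ (finite) and $g_1, g_2 \in G$, let $CSS(G, g_1, g_2)$ be the CSS code on $2|G|$ qubits, labelled by the edges $\{g, g+g_1\}$ and $\{g, g+g_2\}$ ($g \in G$, the $2|G|$ edges being counted as distinct) of the unoriented Cayley graph $(G, g_1, g_2)$, whose stabilizer generator matrices over $\mathbb{F}_2$ are: $\mathbf{H}_X$, the vertex-edge incidence matrix of this graph, and $\mathbf{H}_Z$, the face-edge incidence matrix, the face of $g \in G$ being the 4-cycle $g,\ g+g_1,\ g+g_1+g_2,\ g+g_2$. The CSS code with generator matrices $\mathbf{H}_X, \mathbf{H}_Z$ with $n$ columns is the subspace of $(\mathbb{C}^2)^{\otimes n}$ of all states fixed by the Pauli operators $X^{u}$, $u$ a row of $\mathbf{H}_X$, and $Z^{v}$, $v$ a row of $\mathbf{H}_Z$. The optimal even-distance ($45^\circ$-rotated) 2D surface code with periodicity vectors $(r,r)$ and $(r,-r)$ is $CSS(\mathbb{Z}^2/\mathbb{L}, (1,0) \bmod \mathbb{L}, (0,1) \bmod \mathbb{L})$ with $\mathbb{L} = \mathbb{Z}(r,r) \oplus \mathbb{Z}(r,-r)$.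 For $A, B \in \mathbb{F}_2[X]$ of degree at most $n-1$, the generalized bicycle code $GB(A, B, n)$ is the CSS code of length $2n$ with $\mathbf{H}_X = [\mathbf{A}, \mathbf{B}]$ and $\mathbf{H}_Z = [\mathbf{B}^{\intercal}, \mathbf{A}^{\intercal}]$, where $\mathbf{A}$ and $\mathbf{B}$ are the $n \times n$ circulant matrices whose first columns are the coefficient vectors of $A$ and $B$. Two quantum codes $\mathcal{Q}, \mathcal{Q}' \subseteq (\mathbb{C}^2)^{\otimes n}$ are CGP-equivalent if there is a permutation $\phi$ of the $n$ qubits with $\mathcal{Q}' = \mathbf{P}_\phi(\mathcal{Q})$, where $\mathbf{P}_\phi |t_1 \dots t_n\rangle = |t_{\phi(1)} \dots t_{\phi(n)}\rangle$. Then the optimal even-distance surface code with periodicity vectors $(r,r)$, $(r,-r)$ and the code $GB(1+X, 1+X^{2r-1}, 2r^2)$, both of length $4r^2$, are not CGP-equivalent. -/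

import Mathlib

open scoped Polynomial

namespace QCode

/-- States of qubits labelled by `ι`: the vector `∑ t, ψ t • |t⟩` of `(ℂ²)^{⊗ ι}`, given by its
amplitudes `ψ t` in the computational basis `|t⟩`, `t ∈ 𝔽₂^ι`. -/
abbrev QState (ι : Type*) : Type _ := (ι → ZMod 2) → ℂ

/-- The Pauli operator `X^u`, `|t⟩ ↦ |t + u⟩` (recall `t - u = t + u` over `𝔽₂`). -/
def pauliX {ι : Type*} (u : ι → ZMod 2) : QState ι →ₗ[ℂ] QState ι where
  toFun ψ := fun t => ψ (t - u)
  map_add' _ _ := rfl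
  map_smul' _ _ := rfl

/-- The Pauli operator `Z^v`, `|t⟩ ↦ (-1)^{v · t} |t⟩`. -/
def pauliZ {ι : Type*} [Fintype ι] (v : ι → ZMod 2) : QState ι →ₗ[ℂ] QState ι where
  toFun ψ := fun t => (-1 : ℂ) ^ (v ⬝ᵥ t).val * ψ t
  map_add' ψ χ := by ext t; simp [mul_add]
  map_smul' c ψ := by ext t; simp [mul_left_comm]

/-- The subspace of states fixed by every operator of the set `S`. -/
def fixedSpace {ι : Type*} (S : Set (QState ι →ₗ[ℂ] QState ι)) : Submodule ℂ (QState ι) where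
  carrier := {ψ | ∀ T ∈ S, T ψ = ψ}
  add_mem' ha hb T hT := by rw [map_add, ha T hT, hb T hT]
  zero_mem' T _ := map_zero T
  smul_mem' c ψ h T hT := by rw [map_smul, h T hT]

/-- The stabilizer group of the CSS code with generator matrices `HX`, `HZ`: it is generated by
`X^u` for the rows `u` of `HX` and `Z^v` for the rows `v` of `HZ` (all these are involutions, so
the generated monoid is the generated group). -/
def cssStabilizer {ι m m' : Type*} [Fintype ι]
    (HX : Matrix m ι (ZMod 2)) (HZ : Matrix m' ι (ZMod 2)) :
    Submonoid (Module.End ℂ (QState ι)) :=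
  Submonoid.closure
    (Set.range (fun i : m => pauliX (HX i)) ∪ Set.range (fun i : m' => pauliZ (HZ i)))

/-- The CSS code with generator matrices `HX`, `HZ`, as a subspace of the space of states. -/
def cssCode {ι m m' : Type*} [Fintype ι]
    (HX : Matrix m ι (ZMod 2)) (HZ : Matrix m' ι (ZMod 2)) : Submodule ℂ (QState ι) :=
  fixedSpace (cssStabilizer HX HZ : Set (Module.End ℂ (QState ι)))

/-- The operator `P_φ` permuting the qubits, `|t⟩ ↦ |t ∘ φ⟩`. -/
def permOp {ι κ : Type*} (φ : κ ≃ ι) : QState ι →ₗ[ℂ] QState κ where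
  toFun ψ := fun s => ψ (s ∘ φ.symm)
  map_add' _ _ := rfl
  map_smul' _ _ := rfl

/-- `P_φ` acts on the computational basis by `|t⟩ ↦ |t ∘ φ⟩`. -/
theorem permOp_single {ι κ : Type*} [DecidableEq (ι → ZMod 2)] [DecidableEq (κ → ZMod 2)]
    (φ : κ ≃ ι) (t : ι → ZMod 2) :
    permOp φ (Pi.single t (1 : ℂ)) = Pi.single (t ∘ φ) (1 : ℂ) := by
  ext s
  have h : s ∘ φ.symm = t ↔ s = t ∘ φ := by
    constructor
    · rintro rfl; ext x; simp
    · rintro rfl; ext x; simp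
  simp [permOp, Pi.single_apply, h]

/-- CGP-equivalence: `Q'` is obtained from `Q` by a permutation of the qubits. The qubits of the two
codes may carry different labels, so that a permutation is a bijection between the label sets; for
`ι = κ = {1, …, n}` this is a permutation of `{1, …, n}`. -/
def CGPEquivalent {ι κ : Type*} (Q : Submodule ℂ (QState ι)) (Q' : Submodule ℂ (QState κ)) : Prop :=
  ∃ φ : κ ≃ ι, Q' = Q.map (permOp φ)

section Cayley

variable {G : Type*} [AddCommGroup G] [DecidableEq G]

/-- Vertex-edge incidence matrix (mod 2) of the unoriented Cayley graph `(G, g₁, g₂)`. The edges are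
labelled by `G ⊕ G`: `inl g` is the edge `{g, g + g₁}` and `inr g` is the edge `{g, g + g₂}`. -/
def cayleyHX (g₁ g₂ : G) : Matrix G (G ⊕ G) (ZMod 2) :=
  fun x e => match e with
    | Sum.inl g => (if x = g then 1 else 0) + (if x = g + g₁ then 1 else 0)
    | Sum.inr g => (if x = g then 1 else 0) + (if x = g + g₂ then 1 else 0)

/-- Face-edge incidence matrix (mod 2) of `(G, g₁, g₂)`: the face of `x` consists of the edges
`{x, x + g₁}`, `{x + g₁, x + g₁ + g₂}`, `{x + g₂, x + g₂ + g₁}` and `{x, x + g₂}`. -/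
def cayleyHZ (g₁ g₂ : G) : Matrix G (G ⊕ G) (ZMod 2) :=
  fun x e => match e with
    | Sum.inl g => (if g = x then 1 else 0) + (if g = x + g₂ then 1 else 0)
    | Sum.inr g => (if g = x then 1 else 0) + (if g = x + g₁ then 1 else 0)

/-- The code `CSS(G, g₁, g₂)`. -/
def cayleyCode [Fintype G] (g₁ g₂ : G) : Submodule ℂ (QState (G ⊕ G)) :=
  cssCode (cayleyHX g₁ g₂) (cayleyHZ g₁ g₂)

end Cayley

/-- The lattice `ℤ u + ℤ v ⊆ ℤ²`. -/
def periodLattice (u v : ℤ × ℤ) : AddSubgroup (ℤ × ℤ) := AddSubgroup.closure {u, v}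

/-- The vertices `ℤ² / (ℤ u + ℤ v)` of the square lattice with periodicity vectors `u`, `v`. -/
abbrev TorusGroup (u v : ℤ × ℤ) : Type := (ℤ × ℤ) ⧸ periodLattice u v

open Classical in
/-- The surface code of the square lattice with periodicity vectors `u`, `v`:
`CSS(ℤ²/L, (1,0) mod L, (0,1) mod L)` with `L = ℤ u + ℤ v`. -/
noncomputable def surfaceCode (u v : ℤ × ℤ) [Fintype (TorusGroup u v)] :
    Submodule ℂ (QState (TorusGroup u v ⊕ TorusGroup u v)) :=
  cayleyCode (QuotientAddGroup.mk (1, 0) : TorusGroup u v)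
    (QuotientAddGroup.mk (0, 1) : TorusGroup u v)

/-- `ℤ² / (ℤ (r, r) + ℤ (r, -r))` is isomorphic to `ℤ/r × ℤ/2r`. -/
theorem nonempty_rotatedTorus_addEquiv (r : ℕ) :
    Nonempty (TorusGroup ((r : ℤ), (r : ℤ)) ((r : ℤ), -(r : ℤ)) ≃+ ZMod r × ZMod (2 * r)) := by
  let f : ℤ × ℤ →+ ZMod r × ZMod (2 * r) :=
    AddMonoidHom.prod ((Int.castAddHom (ZMod r)).comp (AddMonoidHom.fst ℤ ℤ))
      ((Int.castAddHom (ZMod (2 * r))).comp (AddMonoidHom.snd ℤ ℤ - AddMonoidHom.fst ℤ ℤ))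
  have hf : Function.Surjective f := by
    rintro ⟨a, b⟩
    obtain ⟨x, rfl⟩ := ZMod.intCast_surjective a
    obtain ⟨y, rfl⟩ := ZMod.intCast_surjective b
    exact ⟨(x, x + y), by simp [f]⟩
  have hk : periodLattice ((r : ℤ), (r : ℤ)) ((r : ℤ), -(r : ℤ)) = f.ker := by
    apply le_antisymm
    · refine (AddSubgroup.closure_le _).mpr ?_
      rintro p (rfl | rfl)
      · simp [f]
      · have h : ((2 * r : ℕ) : ZMod (2 * r)) = 0 := ZMod.natCast_self _
        push_cast at h
        simp only [SetLike.mem_coe, AddMonoidHom.mem_ker, f, AddMonoidHom.prod_apply, Prod.mk_eq_zero]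
        constructor
        · simp
        · simp; linear_combination -h
    · rintro ⟨x, y⟩ h
      simp only [f, AddMonoidHom.mem_ker, AddMonoidHom.prod_apply, Prod.mk_eq_zero] at h
      obtain ⟨h1, h2⟩ := h
      obtain ⟨a, ha⟩ := (ZMod.intCast_zmod_eq_zero_iff_dvd x r).mp h1
      obtain ⟨b, hb⟩ := (ZMod.intCast_zmod_eq_zero_iff_dvd (y - x) (2 * r)).mp h2
      have e : (x, y) = (a + b) • ((r : ℤ), (r : ℤ)) + (-b) • ((r : ℤ), -(r : ℤ)) := by
        push_cast at hb
        ext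
        · simp; linear_combination ha
        · simp; linear_combination ha + hb
      rw [e]
      exact add_mem (zsmul_mem (AddSubgroup.subset_closure (by simp)) _)
        (zsmul_mem (AddSubgroup.subset_closure (by simp)) _)
  exact ⟨(QuotientAddGroup.quotientAddEquivOfEq hk).trans
    (QuotientAddGroup.quotientKerEquivOfSurjective f hf)⟩

theorem finite_rotatedTorus (r : ℕ) [NeZero r] :
    Finite (TorusGroup ((r : ℤ), (r : ℤ)) ((r : ℤ), -(r : ℤ))) := by
  obtain ⟨e⟩ := nonempty_rotatedTorus_addEquiv r
  have : NeZero (2 * r) := ⟨by have := NeZero.ne r; omega⟩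
  exact Finite.of_equiv _ e.symm.toEquiv

noncomputable instance instFintypeRotatedTorus (r : ℕ) [NeZero r] :
    Fintype (TorusGroup ((r : ℤ), (r : ℤ)) ((r : ℤ), -(r : ℤ))) :=
  haveI := finite_rotatedTorus r
  Fintype.ofFinite _

/-- The rotated torus has `2 r ^ 2` vertices; hence the surface code with periodicity vectors
`(r, r)`, `(r, -r)` has length `4 r ^ 2`, the same as a generalized bicycle code on
`Fin (2 * r ^ 2) ⊕ Fin (2 * r ^ 2)`. -/
theorem card_rotatedTorus (r : ℕ) [NeZero r] :
    Fintype.card (TorusGroup ((r : ℤ), (r : ℤ)) ((r : ℤ), -(r : ℤ))) = 2 * r ^ 2 := by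
  obtain ⟨e⟩ := nonempty_rotatedTorus_addEquiv r
  rw [← Nat.card_eq_fintype_card, Nat.card_congr e.toEquiv, Nat.card_prod, Nat.card_zmod,
    Nat.card_zmod]
  ring

/-- The `n × n` circulant matrix of a polynomial `A` of degree at most `n - 1`; its first column is
`a₀, a₁, …, a_{n-1}`. -/
def Circ (A : (ZMod 2)[X]) (n : ℕ) : Matrix (Fin n) (Fin n) (ZMod 2) :=
  Matrix.circulant (fun i : Fin n => A.coeff (i : ℕ))

/-- The generalized bicycle code `GB(A, B, n)` for polynomials `A`, `B` of degree at most `n - 1`: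
the CSS code with `H_X = [Circ A, Circ B]` and `H_Z = [(Circ B)ᵀ, (Circ A)ᵀ]`. -/
def GBCode (A B : (ZMod 2)[X]) (n : ℕ) : Submodule ℂ (QState (Fin n ⊕ Fin n)) :=
  cssCode (Matrix.fromCols (Circ A n) (Circ B n))
    (Matrix.fromCols (Matrix.transpose (Circ B n)) (Matrix.transpose (Circ A n)))

end QCode

/-! Both codes are codes of Cayley graphs: `GBCode_one_add_X_pow` identifies the bicycle code with
that of `ℤ/2r²` and the generators `1`, `2r - 1`. A code determines the kernel of its `HZ`, so a
CGP-equivalence carries one kernel onto the other (`ker_iff_of_map_permOp`). When the generators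
satisfy no nontrivial relation of length at most four, the words of weight four in this kernel are
exactly the vertex stars (`exists_eq_star`). Hence the qubit permutation induces an injective,
adjacency-preserving map of vertices, and such a map preserves straight lines (`straight_line`).

On the torus the line in direction `(1,0)` closes after `2r` steps, because `(2r,0) = (r,r) +
(r,-r)`. In `ℤ/2r²` neither `2r` nor `2r(2r-1)` vanishes, so no straight line closes after `2r`
steps. -/

namespace QCode

/-! ### CSS codes and the kernel of `HZ`. -/

section Support

variable {ι m m' : Type*} [Fintype ι]

theorem mem_cssCode_iff (HX : Matrix m ι (ZMod 2)) (HZ : Matrix m' ι (ZMod 2)) (ψ : QState ι) :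
    ψ ∈ cssCode HX HZ ↔ (∀ i, pauliX (HX i) ψ = ψ) ∧ ∀ i, pauliZ (HZ i) ψ = ψ := by
  constructor
  · intro h
    exact ⟨fun i => h _ (Submonoid.subset_closure (Or.inl ⟨i, rfl⟩)),
      fun i => h _ (Submonoid.subset_closure (Or.inr ⟨i, rfl⟩))⟩
  · rintro ⟨hX, hZ⟩ T hT
    refine Submonoid.closure_induction (motive := fun T _ => T ψ = ψ) ?_ rfl ?_ hT
    · rintro _ (⟨i, rfl⟩ | ⟨i, rfl⟩)
      · exact hX i
      · exact hZ i
    · intro A B _ _ hA hB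
      rw [Module.End.mul_apply, hB, hA]

/-- The basis states occurring in a CSS code are labelled by the kernel of `HZ`. -/
theorem exists_mem_cssCode_ne_zero_iff (HX : Matrix m ι (ZMod 2)) (HZ : Matrix m' ι (ZMod 2))
    (hc : ∀ i j, HZ i ⬝ᵥ HX j = 0) (t : ι → ZMod 2) :
    (∃ ψ ∈ cssCode HX HZ, ψ t ≠ 0) ↔ ∀ i, HZ i ⬝ᵥ t = 0 := by
  classical
  constructor
  · rintro ⟨ψ, hψ, ht⟩ i
    have h := congrFun (((mem_cssCode_iff HX HZ ψ).1 hψ).2 i) t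
    change (-1 : ℂ) ^ (HZ i ⬝ᵥ t).val * ψ t = ψ t at h
    generalize HZ i ⬝ᵥ t = z at h ⊢
    fin_cases z
    · rfl
    · exfalso
      have h1 : (-1 : ℂ) ^ 1 * ψ t = ψ t := h
      apply ht
      linear_combination (-1 / 2 : ℂ) * h1
  · intro ht
    -- The sum of all basis states in the kernel of `HZ`; `hc` makes this kernel stable under
    -- translation by the rows of `HX`.
    refine ⟨fun s => if ∀ i, HZ i ⬝ᵥ s = 0 then 1 else 0, ?_, by simp [ht]⟩
    rw [mem_cssCode_iff]
    constructor
    · intro j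
      ext s
      simp [pauliX, hc, dotProduct_sub]
    · intro i
      ext s
      by_cases hs : ∀ i, HZ i ⬝ᵥ s = 0
      · simp [pauliZ, hs]
      · simp [pauliZ, hs]

/-- A CGP-equivalence between CSS codes permutes the kernels of the matrices `HZ`. -/
theorem ker_iff_of_map_permOp {κ n n' : Type*} [Fintype κ]
    {HX : Matrix m ι (ZMod 2)} {HZ : Matrix m' ι (ZMod 2)}
    {KX : Matrix n κ (ZMod 2)} {KZ : Matrix n' κ (ZMod 2)}
    (hc : ∀ i j, HZ i ⬝ᵥ HX j = 0) (kc : ∀ i j, KZ i ⬝ᵥ KX j = 0) (φ : κ ≃ ι)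
    (h : cssCode KX KZ = (cssCode HX HZ).map (permOp φ)) (t : ι → ZMod 2)
    (ht : ∀ i, HZ i ⬝ᵥ t = 0) (i : n') : KZ i ⬝ᵥ (t ∘ φ) = 0 := by
  obtain ⟨ψ, hψ, hne⟩ := (exists_mem_cssCode_ne_zero_iff HX HZ hc t).2 ht
  refine (exists_mem_cssCode_ne_zero_iff KX KZ kc (t ∘ φ)).1 ⟨permOp φ ψ, ?_, ?_⟩ i
  · rw [h]
    exact Submodule.mem_map_of_mem hψ
  · change ψ ((t ∘ φ) ∘ φ.symm) ≠ 0
    have : (t ∘ φ) ∘ φ.symm = t := by ext; simp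
    rwa [this]

end Support

/-! ### Local comparison of a Cayley graph with the square lattice. -/

section Lattice

variable {G : Type*} [AddCommGroup G]

/-- The four unit steps `g₁, g₂, -g₁, -g₂`; the step opposite to `s` is `s + 2`. -/
def step (g₁ g₂ : G) : Fin 4 → G := ![g₁, g₂, -g₁, -g₂]

/-- The unit steps of `ℤ²`. -/
abbrev unitStep : Fin 4 → ℤ × ℤ := step (1, 0) (0, 1)

theorem abs_unitStep : ∀ s, |(unitStep s).1| + |(unitStep s).2| = 1 := by decide

theorem unitStep_ne_zero : ∀ s, unitStep s ≠ 0 := by decide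

theorem unitStep_injective : Function.Injective unitStep := by decide

theorem abs_unitStep_sub_le : ∀ s s',
    |(unitStep s).1 - (unitStep s').1| + |(unitStep s).2 - (unitStep s').2| ≤ 4 := by decide

theorem step_add_two (g₁ g₂ : G) (s : Fin 4) : step g₁ g₂ (s + 2) = -step g₁ g₂ s := by
  fin_cases s <;> simp [step]

/-- The homomorphism `ℤ² → G` with `(1, 0) ↦ g₁`, `(0, 1) ↦ g₂`. -/
def latticeHom (g₁ g₂ : G) : ℤ × ℤ →+ G where
  toFun p := p.1 • g₁ + p.2 • g₂
  map_zero' := by simp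
  map_add' p q := by simp only [Prod.fst_add, Prod.snd_add, add_smul]; abel

theorem latticeHom_unitStep (g₁ g₂ : G) (s : Fin 4) :
    latticeHom g₁ g₂ (unitStep s) = step g₁ g₂ s := by
  fin_cases s <;> simp [step, latticeHom]

/-- `g₁`, `g₂` satisfy no nontrivial relation of length at most four. -/
def NoShortRelation (g₁ g₂ : G) : Prop :=
  ∀ p : ℤ × ℤ, |p.1| + |p.2| ≤ 4 → latticeHom g₁ g₂ p = 0 → p = 0

theorem NoShortRelation.eq_of_latticeHom_eq {g₁ g₂ : G} (h : NoShortRelation g₁ g₂) {p q : ℤ × ℤ}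
    (hpq : |p.1 - q.1| + |p.2 - q.2| ≤ 4) (he : latticeHom g₁ g₂ p = latticeHom g₁ g₂ q) :
    p = q :=
  sub_eq_zero.1 (h (p - q) hpq (by rw [map_sub, he, sub_self]))

theorem NoShortRelation.step_ne_zero {g₁ g₂ : G} (h : NoShortRelation g₁ g₂) (s : Fin 4) :
    step g₁ g₂ s ≠ 0 := by
  intro h0
  rw [← latticeHom_unitStep] at h0
  exact unitStep_ne_zero s (h _ (abs_unitStep s ▸ by norm_num) h0)

theorem NoShortRelation.step_injective {g₁ g₂ : G} (h : NoShortRelation g₁ g₂) :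
    Function.Injective (step g₁ g₂) := by
  intro s s' h0
  rw [← latticeHom_unitStep, ← latticeHom_unitStep] at h0
  exact unitStep_injective (h.eq_of_latticeHom_eq (abs_unitStep_sub_le s s') h0)

/-- The edge of the Cayley graph leaving the vertex `x` in direction `s`. -/
def edge (g₁ g₂ : G) (x : G) : Fin 4 → G ⊕ G :=
  ![Sum.inl x, Sum.inr x, Sum.inl (x - g₁), Sum.inr (x - g₂)]

/-- The edge of the Cayley graph through which one leaves the face `x` in direction `s`. -/
def dualEdge (g₁ g₂ : G) (x : G) : Fin 4 → G ⊕ G :=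
  ![Sum.inr (x + g₁), Sum.inl (x + g₂), Sum.inr x, Sum.inl x]

theorem edge_reverse (g₁ g₂ x : G) (s : Fin 4) :
    edge g₁ g₂ (x + step g₁ g₂ s) (s + 2) = edge g₁ g₂ x s := by
  fin_cases s <;> simp [edge, step, sub_eq_add_neg]

theorem dualEdge_reverse (g₁ g₂ x : G) (s : Fin 4) :
    dualEdge g₁ g₂ (x + step g₁ g₂ s) (s + 2) = dualEdge g₁ g₂ x s := by
  fin_cases s <;> simp [dualEdge, step]

theorem eq_or_of_edge_eq {g₁ g₂ x y : G} {s s' : Fin 4}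
    (h : edge g₁ g₂ x s = edge g₁ g₂ y s') :
    (x = y ∧ s = s') ∨ (y = x + step g₁ g₂ s ∧ s' = s + 2) := by
  fin_cases s <;> fin_cases s' <;> simp [edge, step] at h ⊢ <;>
    first | exact h | (rw [h]; abel) | (rw [← h]; abel)

theorem eq_or_of_dualEdge_eq {g₁ g₂ x y : G} {s s' : Fin 4}
    (h : dualEdge g₁ g₂ x s = dualEdge g₁ g₂ y s') :
    (x = y ∧ s = s') ∨ (y = x + step g₁ g₂ s ∧ s' = s + 2) := by
  fin_cases s <;> fin_cases s' <;> simp [dualEdge, step] at h ⊢ <;>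
    first | exact h | (rw [h]; done) | (rw [h]; abel)

/-- Coincidences of edges in `G` lift to `ℤ²`. The bound is 3 because crossing an edge adds one
step, and relations are excluded up to length 4. -/
theorem NoShortRelation.eq_or_of_dualEdge_eq {g₁ g₂ : G} (hs : NoShortRelation g₁ g₂)
    {x : G} {p q : ℤ × ℤ} {s s' : Fin 4} (hpq : |p.1 - q.1| + |p.2 - q.2| ≤ 3)
    (h : dualEdge g₁ g₂ (x + latticeHom g₁ g₂ p) s = dualEdge g₁ g₂ (x + latticeHom g₁ g₂ q) s') :
    (p = q ∧ s = s') ∨ (q = p + unitStep s ∧ s' = s + 2) := by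
  rcases QCode.eq_or_of_dualEdge_eq h with ⟨h1, h2⟩ | ⟨h1, h2⟩
  · exact Or.inl ⟨hs.eq_of_latticeHom_eq (by omega) (add_left_cancel h1), h2⟩
  · refine Or.inr ⟨?_, h2⟩
    rw [← latticeHom_unitStep, add_assoc, ← map_add] at h1
    refine hs.eq_of_latticeHom_eq ?_ (add_left_cancel h1)
    have hu := abs_unitStep s
    simp only [Prod.fst_add, Prod.snd_add]
    have e1 := abs_sub_comm p.1 q.1
    have e2 := abs_sub_comm p.2 q.2
    have a1 := abs_sub (q.1 - p.1) (unitStep s).1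
    have a2 := abs_sub (q.2 - p.2) (unitStep s).2
    rw [← sub_sub, ← sub_sub]
    linarith

end Lattice

/-! ### Non-backtracking walks of four steps on faces. -/

section Walks

/-- The edges crossed from `p` in direction `s` and from `q` in direction `s'` in the dual of the
square lattice are distinct, and `p`, `q` are close to each other. -/
def Apart (p : ℤ × ℤ) (s : Fin 4) (q : ℤ × ℤ) (s' : Fin 4) : Prop :=
  |p.1 - q.1| + |p.2 - q.2| ≤ 3 ∧ ¬(p = q ∧ s = s') ∧ ¬(q = p + unitStep s ∧ s' = s + 2)

instance (p : ℤ × ℤ) (s : Fin 4) (q : ℤ × ℤ) (s' : Fin 4) : Decidable (Apart p s q s') :=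
  inferInstanceAs (Decidable (_ ∧ _ ∧ _))

theorem NoShortRelation.dualEdge_ne {G : Type*} [AddCommGroup G] {g₁ g₂ : G}
    (hs : NoShortRelation g₁ g₂) {x : G} {p q : ℤ × ℤ} {s s' : Fin 4} (h : Apart p s q s') :
    dualEdge g₁ g₂ (x + latticeHom g₁ g₂ p) s ≠ dualEdge g₁ g₂ (x + latticeHom g₁ g₂ q) s' :=
  fun he => (hs.eq_or_of_dualEdge_eq h.1 he).elim h.2.1 h.2.2

/-- Such a walk crosses four distinct edges, even when it closes up. -/
theorem walk_apart : ∀ s₁ s₂, s₂ ≠ s₁ + 2 → ∀ s₃, s₃ ≠ s₂ + 2 → ∀ s₄, s₄ ≠ s₃ + 2 →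
    Apart 0 s₁ (0 + unitStep s₁) s₂ ∧
    Apart 0 s₁ (0 + unitStep s₁ + unitStep s₂) s₃ ∧
    Apart 0 s₁ (0 + unitStep s₁ + unitStep s₂ + unitStep s₃) s₄ ∧
    Apart (0 + unitStep s₁) s₂ (0 + unitStep s₁ + unitStep s₂) s₃ ∧
    Apart (0 + unitStep s₁) s₂ (0 + unitStep s₁ + unitStep s₂ + unitStep s₃) s₄ ∧
    Apart (0 + unitStep s₁ + unitStep s₂) s₃
      (0 + unitStep s₁ + unitStep s₂ + unitStep s₃) s₄ := by
  decide

/-- The excluded pattern is the tour of the four faces around a vertex. For any other walk, a second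
edge at the starting face is a fifth edge. -/
theorem walk_end_apart : ∀ s₁ s₂, s₂ ≠ s₁ + 2 → ∀ s₃, s₃ ≠ s₂ + 2 → ∀ s₄, s₄ ≠ s₃ + 2 →
    ∀ s₀, s₀ ≠ s₁ → ¬(s₂ ≠ s₁ ∧ s₃ = s₁ + 2 ∧ s₄ = s₂ + 2) →
    Apart 0 s₀ 0 s₁ ∧
    Apart 0 s₀ (0 + unitStep s₁) s₂ ∧
    Apart 0 s₀ (0 + unitStep s₁ + unitStep s₂) s₃ ∧
    Apart 0 s₀ (0 + unitStep s₁ + unitStep s₂ + unitStep s₃) s₄ := by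
  decide

end Walks

/-! ### Vertex stars as the words of weight four. -/

section Stars

variable {G : Type*} [AddCommGroup G]

theorem NoShortRelation.edge_injective {g₁ g₂ : G} (h : NoShortRelation g₁ g₂) (x : G) :
    Function.Injective (edge g₁ g₂ x) := by
  intro s s' he
  rcases eq_or_of_edge_eq he with ⟨-, h2⟩ | ⟨h1, -⟩
  · exact h2
  · exact absurd (left_eq_add.1 h1) (h.step_ne_zero s)

theorem NoShortRelation.eq_of_range_edge_eq {g₁ g₂ : G} (h : NoShortRelation g₁ g₂) {x y : G}
    (he : Set.range (edge g₁ g₂ x) = Set.range (edge g₁ g₂ y)) : x = y := by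
  by_contra hne
  have key : ∀ s, y = x + step g₁ g₂ s := fun s => by
    obtain ⟨s', hs'⟩ : edge g₁ g₂ x s ∈ Set.range (edge g₁ g₂ y) := he ▸ ⟨s, rfl⟩
    rcases eq_or_of_edge_eq hs'.symm with ⟨h1, -⟩ | ⟨h1, -⟩
    · exact absurd h1 hne
    · exact h1
  have : (0 : Fin 4) = 1 := h.step_injective (add_left_cancel ((key 0).symm.trans (key 1)))
  exact absurd this (by decide)

variable [DecidableEq G]

theorem cayleyHX_ne_zero_iff {g₁ g₂ : G} (h : NoShortRelation g₁ g₂) (x : G) (e : G ⊕ G) :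
    cayleyHX g₁ g₂ x e ≠ 0 ↔ e ∈ Set.range (edge g₁ g₂ x) := by
  have h1 : g₁ ≠ 0 := h.step_ne_zero 0
  have h2 : g₂ ≠ 0 := h.step_ne_zero 1
  have key : ∀ g k : G, k ≠ 0 →
      ((if x = g then 1 else 0) + (if x = g + k then 1 else 0) ≠ (0 : ZMod 2) ↔
        x = g ∨ x - k = g) := by
    intro g k hk
    rw [sub_eq_iff_eq_add]
    by_cases ha : x = g
    · subst ha
      simp [hk]
    · by_cases hb : x = g + k
      · simp [hb, hk]
      · simp [ha, hb]
  simp only [Set.mem_range, Fin.exists_fin_succ]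
  rcases e with g | g
  · simpa [edge, cayleyHX] using key g g₁ h1
  · simpa [edge, cayleyHX] using key g g₂ h2

variable [Fintype G]

theorem cayleyHZ_dotProduct (g₁ g₂ x : G) (t : G ⊕ G → ZMod 2) :
    cayleyHZ g₁ g₂ x ⬝ᵥ t = ∑ s, t (dualEdge g₁ g₂ x s) := by
  simp [dotProduct, cayleyHZ, Fin.sum_univ_four, dualEdge, add_mul, Finset.sum_add_distrib]
  abel

theorem cayleyHZ_dotProduct_cayleyHX (g₁ g₂ x y : G) :
    cayleyHZ g₁ g₂ x ⬝ᵥ cayleyHX g₁ g₂ y = 0 := by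
  rw [cayleyHZ_dotProduct]
  simp only [Fin.sum_univ_four, dualEdge, cayleyHX, Matrix.cons_val, add_right_comm x g₂ g₁]
  generalize (if y = x then (1 : ZMod 2) else 0) = a
  generalize (if y = x + g₁ then (1 : ZMod 2) else 0) = b
  generalize (if y = x + g₂ then (1 : ZMod 2) else 0) = c
  generalize (if y = x + g₁ + g₂ then (1 : ZMod 2) else 0) = d
  revert a b c d
  decide

/-- By parity, a word orthogonal to a face cannot meet it in a single edge; this lets a walk across
the support continue. -/
theorem exists_ne_dualEdge {g₁ g₂ : G} {t : G ⊕ G → ZMod 2}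
    (ht : ∀ x, cayleyHZ g₁ g₂ x ⬝ᵥ t = 0) {x : G} {s : Fin 4} (h : t (dualEdge g₁ g₂ x s) ≠ 0) :
    ∃ s', s' ≠ s ∧ t (dualEdge g₁ g₂ x s') ≠ 0 := by
  by_contra! hc
  have := ht x
  rw [cayleyHZ_dotProduct, Finset.sum_eq_single s (fun s' _ hs' => hc s' hs') (by simp)] at this
  exact h this

theorem exists_ne_dualEdge_add {g₁ g₂ : G} {t : G ⊕ G → ZMod 2}
    (ht : ∀ x, cayleyHZ g₁ g₂ x ⬝ᵥ t = 0) {x : G} {p : ℤ × ℤ} {s : Fin 4}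
    (h : t (dualEdge g₁ g₂ (x + latticeHom g₁ g₂ p) s) ≠ 0) :
    ∃ s', s' ≠ s + 2 ∧ t (dualEdge g₁ g₂ (x + latticeHom g₁ g₂ (p + unitStep s)) s') ≠ 0 := by
  rw [map_add, latticeHom_unitStep, ← add_assoc]
  rw [← dualEdge_reverse] at h
  exact exists_ne_dualEdge ht h

/-- A word of weight four orthogonal to all faces is the star of a vertex. -/
theorem NoShortRelation.exists_eq_star {g₁ g₂ : G} (hs : NoShortRelation g₁ g₂)
    {t : G ⊕ G → ZMod 2} (ht : ∀ x, cayleyHZ g₁ g₂ x ⬝ᵥ t = 0)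
    (hw : (Finset.univ.filter fun e => t e ≠ 0).card = 4) :
    ∃ y, ∀ e, t e ≠ 0 ↔ e ∈ Set.range (edge g₁ g₂ y) := by
  have hface : ∃ x s, t (dualEdge g₁ g₂ x s) ≠ 0 := by
    obtain ⟨e, he⟩ : (Finset.univ.filter fun e => t e ≠ 0).Nonempty :=
      Finset.card_pos.1 (by omega)
    rcases e with g | g
    · exact ⟨g, 3, by simpa [dualEdge] using he⟩
    · exact ⟨g, 2, by simpa [dualEdge] using he⟩
  obtain ⟨x, s₁, h₁⟩ := hface
  obtain ⟨s₀, n₀, h₀⟩ := exists_ne_dualEdge ht h₁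
  have e0 : ∀ s, dualEdge g₁ g₂ x s = dualEdge g₁ g₂ (x + latticeHom g₁ g₂ 0) s := by simp
  rw [e0] at h₁ h₀
  obtain ⟨s₂, n₂, h₂⟩ := exists_ne_dualEdge_add ht h₁
  obtain ⟨s₃, n₃, h₃⟩ := exists_ne_dualEdge_add ht h₂
  obtain ⟨s₄, n₄, h₄⟩ := exists_ne_dualEdge_add ht h₃
  obtain ⟨q₁₂, q₁₃, q₁₄, q₂₃, q₂₄, q₃₄⟩ := walk_apart s₁ s₂ n₂ s₃ n₃ s₄ n₄
  have d₁₂ := hs.dualEdge_ne (x := x) q₁₂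
  have d₁₃ := hs.dualEdge_ne (x := x) q₁₃
  have d₁₄ := hs.dualEdge_ne (x := x) q₁₄
  have d₂₃ := hs.dualEdge_ne (x := x) q₂₃
  have d₂₄ := hs.dualEdge_ne (x := x) q₂₄
  have d₃₄ := hs.dualEdge_ne (x := x) q₃₄
  -- The four crossed edges are distinct, hence exhaust the support.
  have hF : ({dualEdge g₁ g₂ (x + latticeHom g₁ g₂ 0) s₁,
      dualEdge g₁ g₂ (x + latticeHom g₁ g₂ (0 + unitStep s₁)) s₂,
      dualEdge g₁ g₂ (x + latticeHom g₁ g₂ (0 + unitStep s₁ + unitStep s₂)) s₃,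
      dualEdge g₁ g₂ (x + latticeHom g₁ g₂ (0 + unitStep s₁ + unitStep s₂ + unitStep s₃)) s₄} :
        Finset (G ⊕ G)) = Finset.univ.filter fun e => t e ≠ 0 := by
    refine Finset.eq_of_subset_of_card_le ?_ ?_
    · intro e he
      simp only [Finset.mem_insert, Finset.mem_singleton] at he
      simp only [Finset.mem_filter, Finset.mem_univ, true_and]
      rcases he with rfl | rfl | rfl | rfl <;> assumption
    · rw [hw, Finset.card_insert_of_notMem, Finset.card_insert_of_notMem, Finset.card_pair d₃₄]
      · simpa only [Finset.mem_insert, Finset.mem_singleton, not_or] using ⟨d₂₃, d₂₄⟩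
      · simpa only [Finset.mem_insert, Finset.mem_singleton, not_or] using ⟨d₁₂, d₁₃, d₁₄⟩
  have hmem : ∀ e, t e ≠ 0 ↔ _ := fun e =>
    ((Finset.mem_filter_univ (p := fun e => t e ≠ 0) e).symm.trans (by rw [← hF]) :
      t e ≠ 0 ↔ e ∈ _)
  -- The second edge `s₀` of the starting face also lies in the support, which leaves no room for a
  -- fifth edge.
  have hclosed : s₂ ≠ s₁ ∧ s₃ = s₁ + 2 ∧ s₄ = s₂ + 2 := by
    by_contra hc
    obtain ⟨r₁, r₂, r₃, r₄⟩ := walk_end_apart s₁ s₂ n₂ s₃ n₃ s₄ n₄ s₀ n₀ hc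
    have := (hmem _).1 h₀
    simp only [Finset.mem_insert, Finset.mem_singleton, hs.dualEdge_ne r₁, hs.dualEdge_ne r₂,
      hs.dualEdge_ne r₃, hs.dualEdge_ne r₄, or_self] at this
  obtain ⟨n₁₂, rfl, rfl⟩ := hclosed
  -- The common corner of the four faces. One of `s₁`, `s₂` is horizontal and the other vertical; a
  -- positive step moves the corner from `x` by that generator, a negative one does not.
  refine ⟨x + (if s₁ = 0 ∨ s₂ = 0 then g₁ else 0) + (if s₁ = 1 ∨ s₂ = 1 then g₂ else 0),
    fun e => (hmem e).trans ?_⟩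
  simp only [map_add, latticeHom_unitStep, map_zero, Set.mem_range, Fin.exists_fin_succ]
  clear * - n₁₂ n₂
  fin_cases s₁ <;> fin_cases s₂ <;> simp at n₁₂ n₂ <;>
    simp only [Fin.mk_one, Fin.zero_eta, Fin.reduceFinMk] <;>
    rcases e with g | g <;> simp [dualEdge, edge, step, eq_comm (b := g)] <;> abel_nf <;> tauto

end Stars

/-! ### Rigidity of adjacency-preserving maps. -/

section StraightLines

variable {G G' : Type*} [AddCommGroup G] [AddCommGroup G'] {g₁ g₂ : G} {g₁' g₂' : G'}

theorem unitStep_common_neighbour : ∀ s u u',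
    unitStep s + unitStep u = unitStep (s + 2) + unitStep u' → u = s + 2 := by
  decide

theorem unitStep_add_eq_zero : ∀ a b, unitStep a + unitStep b = 0 → b = a + 2 := by
  decide

theorem abs_unitStep_add_le : ∀ s u,
    |(unitStep s + unitStep u).1| + |(unitStep s + unitStep u).2| ≤ 4 := by
  decide

theorem abs_unitStep_add_sub_le : ∀ s u u',
    |(unitStep s + unitStep u).1 - (unitStep (s + 2) + unitStep u').1| +
      |(unitStep s + unitStep u).2 - (unitStep (s + 2) + unitStep u').2| ≤ 4 := by
  decide

/-- An injective map preserving adjacency sends opposite neighbours to opposite neighbours, since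
these are the pairs of neighbours without a second common neighbour. -/
theorem direction_opposite (h : NoShortRelation g₁ g₂) (h' : NoShortRelation g₁' g₂')
    {f : G → G'} (hf : Function.Injective f) {σ : G → Fin 4 → Fin 4}
    (hσ : ∀ x s, f (x + step g₁ g₂ s) = f x + step g₁' g₂' (σ x s)) (x : G) (s : Fin 4) :
    σ x (s + 2) = σ x s + 2 := by
  have hsurj : ∀ y, Function.Surjective (σ y) := fun y => by
    refine Finite.surjective_of_injective fun a b hab => h.step_injective ?_
    refine add_left_cancel (hf (?_ : f (y + step g₁ g₂ a) = f (y + step g₁ g₂ b)))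
    rw [hσ, hσ, hab]
  -- Adding both image steps to `f x` gives a common neighbour of the two images. It pulls back to a
  -- common neighbour of two opposite neighbours of `x`, which can only be `x`; so the two image
  -- steps cancel.
  obtain ⟨u, hu⟩ := hsurj (x + step g₁ g₂ s) (σ x (s + 2))
  obtain ⟨u', hu'⟩ := hsurj (x + step g₁ g₂ (s + 2)) (σ x s)
  have e₁ := hσ (x + step g₁ g₂ s) u
  have e₂ := hσ (x + step g₁ g₂ (s + 2)) u'
  rw [hu, hσ x s] at e₁
  rw [hu', hσ x (s + 2), add_right_comm (f x), ← e₁] at e₂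
  have e₃ := hf e₂
  rw [add_assoc, add_assoc] at e₃
  have e₄ := add_left_cancel e₃
  rw [← latticeHom_unitStep, ← latticeHom_unitStep, ← latticeHom_unitStep, ← latticeHom_unitStep,
    ← map_add, ← map_add] at e₄
  have hu₂ : u = s + 2 := unitStep_common_neighbour s u u'
    (h.eq_of_latticeHom_eq (abs_unitStep_add_sub_le s u u') e₄.symm)
  rw [hu₂, step_add_two, add_neg_cancel_right, add_assoc, left_eq_add, ← latticeHom_unitStep,
    ← latticeHom_unitStep, ← map_add] at e₁
  exact unitStep_add_eq_zero _ _ (h' _ (abs_unitStep_add_le _ _) e₁)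

/-- An injective map preserving adjacency sends straight lines to straight lines. -/
theorem straight_line (h : NoShortRelation g₁ g₂) (h' : NoShortRelation g₁' g₂')
    {f : G → G'} (hf : Function.Injective f) {σ : G → Fin 4 → Fin 4}
    (hσ : ∀ x s, f (x + step g₁ g₂ s) = f x + step g₁' g₂' (σ x s)) (x : G) (s : Fin 4) (k : ℕ) :
    f (x + k • step g₁ g₂ s) = f x + k • step g₁' g₂' (σ x s) := by
  -- The step `s + 2` from the next vertex leads back to `y`, so the image directions of the two
  -- successive steps agree.
  have hconst : ∀ y, σ (y + step g₁ g₂ s) s = σ y s := fun y => by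
    have e := hσ (y + step g₁ g₂ s) (s + 2)
    rw [direction_opposite h h' hf hσ, step_add_two, step_add_two, add_neg_cancel_right, hσ,
      add_assoc, left_eq_add, ← sub_eq_add_neg, sub_eq_zero] at e
    exact (h'.step_injective e).symm
  induction k generalizing x with
  | zero => simp
  | succ k ih => rw [succ_nsmul', ← add_assoc, ih, hconst, hσ, succ_nsmul', add_assoc]

variable [Fintype G] [Fintype G'] [DecidableEq G] [DecidableEq G']

/-- The star of `x` is a row of `HX`, so it is a kernel word of weight four and is transported to
the star of some `f x`. Adjacency survives because neighbouring stars share an edge. -/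
theorem CGPEquivalent.exists_vertex_map (h : NoShortRelation g₁ g₂)
    (h' : NoShortRelation g₁' g₂') (hQ : CGPEquivalent (cayleyCode g₁ g₂) (cayleyCode g₁' g₂')) :
    ∃ f : G → G', Function.Injective f ∧
      ∀ x s, ∃ a, f (x + step g₁ g₂ s) = f x + step g₁' g₂' a := by
  obtain ⟨φ, hφ⟩ := hQ
  have hstar : ∀ x, ∃ y, ∀ e,
      φ e ∈ Set.range (edge g₁ g₂ x) ↔ e ∈ Set.range (edge g₁' g₂' y) := fun x => by
    obtain ⟨y, hy⟩ := h'.exists_eq_star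
      (ker_iff_of_map_permOp (cayleyHZ_dotProduct_cayleyHX g₁ g₂)
        (cayleyHZ_dotProduct_cayleyHX g₁' g₂') φ hφ (cayleyHX g₁ g₂ x)
        fun i => cayleyHZ_dotProduct_cayleyHX g₁ g₂ i x) (by
        have : (Finset.univ.image (edge g₁ g₂ x)).card = 4 := by
          rw [Finset.card_image_of_injective _ (h.edge_injective x), Finset.card_fin]
        rw [← this]
        refine Finset.card_equiv φ fun e => ?_
        simpa using cayleyHX_ne_zero_iff h x (φ e))
    exact ⟨y, fun e => (cayleyHX_ne_zero_iff h x (φ e)).symm.trans (hy e)⟩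
  choose f hf using hstar
  have hinj : Function.Injective f := fun x y hxy => by
    refine h.eq_of_range_edge_eq (Set.ext fun e => ?_)
    rw [← φ.apply_symm_apply e, hf, hf, hxy]
  refine ⟨f, hinj, fun x s => ?_⟩
  obtain ⟨a, ha⟩ := (hf x (φ.symm (edge g₁ g₂ x s))).1 ⟨s, by simp⟩
  obtain ⟨b, hb⟩ := (hf (x + step g₁ g₂ s) (φ.symm (edge g₁ g₂ x s))).1
    ⟨s + 2, by simp [edge_reverse]⟩
  rcases eq_or_of_edge_eq (ha.trans hb.symm) with ⟨e, -⟩ | ⟨e, -⟩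
  · exact absurd (left_eq_add.1 (hinj e)) (h.step_ne_zero s)
  · exact ⟨a, e⟩

/-- Codes of Cayley graphs are told apart by the lengths of their straight cycles. -/
theorem not_CGPEquivalent_cayleyCode (h : NoShortRelation g₁ g₂) (h' : NoShortRelation g₁' g₂')
    {k : ℕ} (hk : k • g₁ = 0) (hk₁ : k • g₁' ≠ 0) (hk₂ : k • g₂' ≠ 0) :
    ¬CGPEquivalent (cayleyCode g₁ g₂) (cayleyCode g₁' g₂') := by
  intro hQ
  obtain ⟨f, hf, hadj⟩ := hQ.exists_vertex_map h h'
  choose σ hσ using hadj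
  have e := straight_line h h' hf hσ 0 0 k
  have h0 : k • step g₁ g₂ 0 = 0 := hk
  rw [h0, add_zero, left_eq_add] at e
  generalize σ 0 0 = a at e
  fin_cases a <;> simp [step] at e <;> contradiction

end StraightLines

/-! ### The rotated torus. -/

section Torus

theorem noShortRelation_rotatedTorus {r : ℕ} (hr : 3 ≤ r) :
    NoShortRelation
      (QuotientAddGroup.mk (1, 0) : TorusGroup ((r : ℤ), (r : ℤ)) ((r : ℤ), -(r : ℤ)))
      (QuotientAddGroup.mk (0, 1)) := by
  rintro ⟨a, b⟩ hab h0
  have h1 :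
      (QuotientAddGroup.mk (a, b) : TorusGroup ((r : ℤ), (r : ℤ)) ((r : ℤ), -(r : ℤ))) = 0 := by
    rw [← h0]
    change _ =
      a • (QuotientAddGroup.mk (1, 0) : TorusGroup ((r : ℤ), (r : ℤ)) ((r : ℤ), -(r : ℤ))) +
      b • (QuotientAddGroup.mk (0, 1) : TorusGroup ((r : ℤ), (r : ℤ)) ((r : ℤ), -(r : ℤ)))
    rw [← QuotientAddGroup.mk_zsmul, ← QuotientAddGroup.mk_zsmul, ← QuotientAddGroup.mk_add]
    simp
  rw [QuotientAddGroup.eq_zero_iff, periodLattice, AddSubgroup.mem_closure_pair] at h1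
  obtain ⟨m, n, h2⟩ := h1
  simp only [Prod.smul_mk, smul_eq_mul, Prod.mk_add_mk, Prod.mk.injEq] at h2
  obtain ⟨rfl, rfl⟩ := h2
  have hr' : (3 : ℤ) ≤ r := by exact_mod_cast hr
  simp only at hab
  have e₁ : m * r + n * r = (m + n) * r := by ring
  have e₂ : m * r + n * -r = (m - n) * r := by ring
  rw [e₁, e₂, abs_mul, abs_mul, Nat.abs_cast, ← add_mul] at hab
  have h3 : |m + n| + |m - n| < 2 := by nlinarith
  -- `|m + n| + |m - n|` is twice the larger of `|m|`, `|n|`, so being less than 2 it vanishes.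
  obtain ⟨rfl, rfl⟩ : m = 0 ∧ n = 0 := by
    constructor <;> cases abs_cases (m + n) <;> cases abs_cases (m - n) <;> omega
  simp

theorem nsmul_rotatedTorus (r : ℕ) :
    (2 * r) • (QuotientAddGroup.mk (1, 0) : TorusGroup ((r : ℤ), (r : ℤ)) ((r : ℤ), -(r : ℤ))) =
      0 := by
  rw [← QuotientAddGroup.mk_nsmul, QuotientAddGroup.eq_zero_iff, periodLattice,
    AddSubgroup.mem_closure_pair]
  exact ⟨1, 1, by ext <;> simp; ring⟩

end Torus

/-! ### The cyclic group of the bicycle code. -/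

section Bicycle

theorem coeff_one_add_X_pow (k i : ℕ) :
    (1 + Polynomial.X ^ k : (ZMod 2)[X]).coeff i =
      (if i = 0 then 1 else 0) + (if i = k then 1 else 0) := by
  rw [Polynomial.coeff_add, Polynomial.coeff_one, Polynomial.coeff_X_pow]

theorem circ_one_add_X_pow {n k : ℕ} [NeZero n] (hk : k < n) (i j : Fin n) :
    Circ (1 + Polynomial.X ^ k) n i j =
      (if i = j then 1 else 0) + (if i = j + Fin.ofNat n k then 1 else 0) := by
  rw [Circ, Matrix.circulant_apply, coeff_one_add_X_pow]
  congr 1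
  · simp [sub_eq_zero]
  · refine if_congr ?_ rfl rfl
    rw [← sub_eq_iff_eq_add', Fin.ext_iff]
    simp [Nat.mod_eq_of_lt hk]

/-- The generalized bicycle code of `1 + X ^ k`, `1 + X ^ l` is the code of a Cayley graph of the
cyclic group. -/
theorem GBCode_one_add_X_pow {n k l : ℕ} [NeZero n] (hk : k < n) (hl : l < n) :
    GBCode (1 + Polynomial.X ^ k) (1 + Polynomial.X ^ l) n =
      cayleyCode (Fin.ofNat n k) (Fin.ofNat n l) := by
  rw [GBCode, cayleyCode]
  congr 1
  · ext i (j | j) <;> simp [cayleyHX, circ_one_add_X_pow, hk, hl]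
  · ext i (j | j) <;> simp [cayleyHZ, circ_one_add_X_pow, hk, hl]

theorem zsmul_ofNat_add_zsmul_ofNat_eq_zero_iff {n : ℕ} [NeZero n] (k l : ℕ) (a b : ℤ) :
    a • Fin.ofNat n k + b • Fin.ofNat n l = 0 ↔ (n : ℤ) ∣ a * k + b * l := by
  obtain _ | n := n
  · exact absurd rfl (NeZero.ne 0)
  · have e : ∀ k : ℕ, Fin.ofNat (n + 1) k = ((k : ℕ) : ZMod (n + 1)) := fun k => by
      rfl
    rw [← ZMod.intCast_zmod_eq_zero_iff_dvd]
    push_cast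
    rw [← zsmul_eq_mul, ← zsmul_eq_mul]
    exact Iff.rfl

/-- A relation reads `a + b(2r-1) = 2r²c`. The left side is less than `8r < 4r²` in absolute value,
so `|c| < 2` and finitely many pairs `(b, c)` remain. -/
theorem noShortRelation_bicycle {r : ℕ} [NeZero (2 * r ^ 2)] (hr : 3 ≤ r) :
    NoShortRelation (Fin.ofNat (2 * r ^ 2) 1) (Fin.ofNat (2 * r ^ 2) (2 * r - 1)) := by
  rintro ⟨a, b⟩ hab h0
  obtain ⟨c, hc⟩ := (zsmul_ofNat_add_zsmul_ofNat_eq_zero_iff _ _ _ _).1 h0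
  have hr' : (3 : ℤ) ≤ r := by exact_mod_cast hr
  rw [Nat.cast_sub (by omega)] at hc
  push_cast at hc
  simp only at hab
  generalize (r : ℤ) = R at hc hr'
  have ha := abs_le.1 (show |a| ≤ 4 - |b| by linarith)
  have hb := abs_le.1 (show |b| ≤ 4 by linarith [abs_nonneg a])
  -- Replaces `R ^ 2` by linear information, sufficient for the final cases to be linear arithmetic;
  -- `R = 3` needs the exact value.
  have hQ : R ^ 2 = 9 ∧ R = 3 ∨ 4 * R ≤ R ^ 2 ∧ 4 ≤ R := by
    rcases hr'.eq_or_lt with rfl | h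
    · exact Or.inl ⟨by norm_num, rfl⟩
    · exact Or.inr ⟨by nlinarith, h⟩
  generalize R ^ 2 = Q at hc hQ
  obtain ⟨hb₁, hb₂⟩ := hb
  have hc₁ : -2 < c := by
    by_contra! h
    have : Q * (c + 2) ≤ 0 := mul_nonpos_of_nonneg_of_nonpos (by omega) (by omega)
    have : 0 ≤ (b + 4) * (2 * R - 1) := mul_nonneg (by omega) (by omega)
    have := abs_nonneg b
    linarith [show 8 * R < 4 * Q by omega]
  have hc₂ : c < 2 := by
    by_contra! h
    have : 0 ≤ Q * (c - 2) := mul_nonneg (by omega) (by omega)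
    have : 0 ≤ (4 - b) * (2 * R - 1) := mul_nonneg (by omega) (by omega)
    have := abs_nonneg b
    linarith [show 8 * R < 4 * Q by omega]
  rw [Prod.mk_eq_zero]
  interval_cases b <;> interval_cases c <;> norm_num at ha hc ⊢ <;> omega

theorem nsmul_ofNat_one_ne_zero {r : ℕ} [NeZero (2 * r ^ 2)] (hr : 3 ≤ r) :
    (2 * r) • Fin.ofNat (2 * r ^ 2) 1 ≠ 0 := by
  intro h
  have := (zsmul_ofNat_add_zsmul_ofNat_eq_zero_iff (n := 2 * r ^ 2) 1 0 (2 * r : ℕ) 0).1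
    (by rw [natCast_zsmul, h, zero_zsmul, add_zero])
  rw [Nat.cast_one, mul_one, zero_mul, add_zero, Int.natCast_dvd_natCast] at this
  have := Nat.le_of_dvd (by omega) this
  nlinarith

theorem nsmul_ofNat_two_mul_sub_one_ne_zero {r : ℕ} [NeZero (2 * r ^ 2)] (hr : 3 ≤ r) :
    (2 * r) • Fin.ofNat (2 * r ^ 2) (2 * r - 1) ≠ 0 := by
  intro h
  have := (zsmul_ofNat_add_zsmul_ofNat_eq_zero_iff (n := 2 * r ^ 2) (2 * r - 1) 0 (2 * r : ℕ) 0).1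
    (by rw [natCast_zsmul, h, zero_zsmul, add_zero])
  rw [zero_mul, add_zero, ← Nat.cast_mul, Int.natCast_dvd_natCast, pow_two, ← mul_assoc] at this
  have h₁ := Nat.dvd_of_mul_dvd_mul_left (k := 2 * r) (by omega) this
  -- `2r² ∣ 2r(2r-1)` would give `r ∣ 2r - 1`, hence `r ∣ 1`.
  have h₂ : r ∣ 2 * r - (2 * r - 1) := Nat.dvd_sub (Dvd.intro_left 2 rfl) h₁
  rw [show 2 * r - (2 * r - 1) = 1 by omega] at h₂
  have := Nat.le_of_dvd one_pos h₂
  omega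

end Bicycle

end QCode

theorem mainTheorem4 (r : ℕ) [NeZero r] (hr : 3 ≤ r) :
    ¬ QCode.CGPEquivalent
      (QCode.surfaceCode ((r : ℤ), (r : ℤ)) ((r : ℤ), -(r : ℤ)))
      (QCode.GBCode (1 + Polynomial.X) (1 + Polynomial.X ^ (2 * r - 1)) (2 * r ^ 2)) := by
  have : NeZero (2 * r ^ 2) := ⟨by positivity⟩
  have h₁ : 1 < 2 * r ^ 2 := by nlinarith
  have h₂ : 2 * r - 1 < 2 * r ^ 2 := by
    have : 2 * r < 2 * r ^ 2 := by nlinarith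
    omega
  have h := QCode.GBCode_one_add_X_pow h₁ h₂
  rw [pow_one] at h
  rw [h, QCode.surfaceCode]
  classical
  refine QCode.not_CGPEquivalent_cayleyCode (QCode.noShortRelation_rotatedTorus hr)
    (QCode.noShortRelation_bicycle hr) (QCode.nsmul_rotatedTorus r) ?_ ?_
  · exact QCode.nsmul_ofNat_one_ne_zero hr
  · exact QCode.nsmul_ofNat_two_mul_sub_one_ne_zero hr
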